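/- \textbf{Theorem (asymptotic boundedness of the classical distributed set-membership filter).} Consider the linear system $x_{k+1}=Ax_k+Bw_k$, $k\in\mathbb N_0$, with $A\in\mathbb R^{n\times n}$ nonsingular and $B\in\mathbb R^{n\times p}$, and a finite set $V$ of sensors with measurements $y_k^i=C_ix_k+v_k^i$, $C_i\in\mathbb R^{q_i\times n}$ ($q_i=0$ if sensor $i$ takes no measurements). Here $x_0$, $w_k$ and $v_k^i$ are uncertain variables, i.e. functions on a sample space $\Omega$; $[\![z]\!]=\{z(\omega):\omega\in\Omega\}$ denotes the range of an uncertain variable $z$, and $D(S)=\sup_{s,s'\in S}\|s-s'\|\in[0,\infty]$ the Euclidean diameter of a set $S$. Assume that the noises are uniformly bounded: $\sup_kD([\![w_k]\!])<\infty$ and $\sup_kD([\![v_k^i]\!])<\infty$ for every $i\in V$. The sensors communicate over a directed graph $G=(V,E)$, where $(j,i)\in E$ means that $i$ receives from $j$. Fix a realization $\omega\in\Omega$, with measurements $y_k^i=y_k^i(\omega)$, and initial prior beliefs $\mathcal B_i^-(x_0)\subseteq\mathbb R^n$, $i\in V$. The classical distributed set-membership filter computes, for all $k\in\mathbb N_0$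 and $i\in V$, $$\mathcal B_i^+(x_k)=\{x\in\mathbb R^n:\ y_k^i=C_ix+v\text{ for some }v\in[\![v_k^i]\!]\}\cap\mathcal B_i^-(x_k),$$ $$\mathcal B_i(x_k)=\bigcap_{j=i\text{ or }(j,i)\in E}\mathcal B_j^+(x_k),\qquad \mathcal B_i^-(x_{k+1})=A\,\mathcal B_i(x_k)+B[\![w_k]\!],$$ where the last sum is a Minkowski sum. A source component of $G$ is a strongly connected component that no edge enters from outside. For each source component, with vertex set $V_t$, let $C^{(t)}$ be the matrix obtained by stacking the $C_i$, $i\in V_t$, and let $P^{(t)}=\begin{bmatrix}P_o\\P_{\bar o}\end{bmatrix}\in\mathbb R^{n\times n}$ be a nonsingular matrix giving an observability decomposition $$P^{(t)}A(P^{(t)})^{-1}=\begin{bmatrix}\tilde A_o&0\\\tilde A_{21}&\tilde A_{\bar o}\end{bmatrix},\quad P^{(t)}B=\begin{bmatrix}\tilde B_o\\\tilde B_{\bar o}\end{bmatrix},\quad C^{(t)}(P^{(t)})^{-1}=\begin{bmatrix}\tilde C_o&0\end{bmatrix},\qquad(\tilde A_o,\tilde C_o)\text{ observable}.$$ Suppose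 that for every source component the following two conditions hold. (i) $\tilde A_{\bar o}$ is marginally stable: every eigenvalue $\lambda\in\mathbb C$ of $\tilde A_{\bar o}$ satisfies $|\lambda|\le1$, and those with $|\lambda|=1$ are semisimple. (ii) For every eigenvalue $\lambda\in\mathbb C$ of $\tilde A_{\bar o}$ with $|\lambda|=1$, $$\operatorname{rank}\begin{bmatrix}\tilde A_{\bar o}-\lambda I&\tilde B_{\bar o}&\tilde A_{21}\end{bmatrix}=\operatorname{rank}\bigl(\tilde A_{\bar o}-\lambda I\bigr).$$ Then for every sensor $i\in V$ with $D(\mathcal B_i^-(x_0))<\infty$, $$\limsup_{k\to\infty}D(\mathcal B_i(x_k))<\infty.$$ -/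

import Mathlib

open Set Filter Topology
open scoped Pointwise Matrix

noncomputable section

/-! ### Communication digraph -/

/-- `j` has a directed path (possibly of length zero) to `i`. -/
def Digraph.HasPath {V : Type*} (G : Digraph V) (j i : V) : Prop :=
  Relation.ReflTransGen G.Adj j i

/-- `S` is (the vertex set of) a strongly connected component of `G`: a class of the relation
"there are directed paths in both directions". -/
def Digraph.IsStrongComponent {V : Type*} (G : Digraph V) (S : Set V) : Prop :=
  ∃ i, S = {j | G.HasPath i j ∧ G.HasPath j i}

/-- A source component: a strongly connected component that no edge enters from outside. -/
def Digraph.IsSourceComponent {V : Type*} (G : Digraph V) (S : Set V) : Prop :=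
  G.IsStrongComponent S ∧ ∀ i ∉ S, ∀ j ∈ S, ¬ G.Adj i j

/-- Sensor `i` together with its in-neighbours. -/
def Digraph.closedInNeighbors {V : Type*} (G : Digraph V) (i : V) : Set V :=
  {i} ∪ {j | G.Adj j i}

/-! ### System model -/

/-- The data of a linear system observed by a network of sensors `V`. The uncertain variables are
functions on a sample space `Ω`. An edge `(j, i)` of `graph` means that `i` receives from `j`. A
sensor without measurements is one with `q i = 0` (or with `C i = 0`). -/
structure SensorNetwork (V Ω : Type*) (n p : ℕ) where
  /-- the communication digraph -/
  graph : Digraph V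
  /-- the system matrix -/
  A : Matrix (Fin n) (Fin n) ℝ
  /-- the noise input matrix -/
  B : Matrix (Fin n) (Fin p) ℝ
  /-- the number of scalar measurements of a sensor -/
  q : V → ℕ
  /-- the measurement matrices -/
  C : (i : V) → Matrix (Fin (q i)) (Fin n) ℝ
  /-- the initial state -/
  x₀ : Ω → EuclideanSpace ℝ (Fin n)
  /-- the process noise -/
  w : ℕ → Ω → EuclideanSpace ℝ (Fin p)
  /-- the measurement noises -/
  v : (i : V) → ℕ → Ω → EuclideanSpace ℝ (Fin (q i))

namespace SensorNetwork

variable {V Ω : Type*} {n p : ℕ} (N : SensorNetwork V Ω n p)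

/-- The state: `x_{k+1} = A x_k + B w_k`. -/
def state : ℕ → Ω → EuclideanSpace ℝ (Fin n)
  | 0, ω => N.x₀ ω
  | k + 1, ω => Matrix.toEuclideanLin N.A (state k ω) + Matrix.toEuclideanLin N.B (N.w k ω)

/-- The measurements: `y_k^i = C_i x_k + v_k^i`. -/
def measurement (i : V) (k : ℕ) (ω : Ω) : EuclideanSpace ℝ (Fin (N.q i)) :=
  Matrix.toEuclideanLin (N.C i) (N.state k ω) + N.v i k ω

/-- The joint measurement matrix of the sensors in `S`: the matrices `C_i`, `i ∈ S`, stacked. -/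
def jointC (S : Set V) : Matrix (Σ i : S, Fin (N.q i)) (Fin n) ℝ :=
  Matrix.of fun r => N.C r.1 r.2

end SensorNetwork

/-! ### The classical distributed set-membership filter -/

/-- The states that are compatible with a measurement `y = C x + v`, `v ∈ R`. -/
def compatibleStates {n q : ℕ} (C : Matrix (Fin q) (Fin n) ℝ) (y : EuclideanSpace ℝ (Fin q))
    (R : Set (EuclideanSpace ℝ (Fin q))) : Set (EuclideanSpace ℝ (Fin n)) :=
  {x | ∃ v ∈ R, y = Matrix.toEuclideanLin C x + v}

namespace SensorNetwork

variable {V Ω : Type*} {n p : ℕ} (N : SensorNetwork V Ω n p)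

/-- Local prediction `A 𝓑 + B ⟦w_k⟧` (image sets and Minkowski sum). -/
def predict (k : ℕ) (S : Set (EuclideanSpace ℝ (Fin n))) : Set (EuclideanSpace ℝ (Fin n)) :=
  Matrix.toEuclideanLin N.A '' S + Matrix.toEuclideanLin N.B '' range (N.w k)

/-- Local measurement update `𝓧_k(C_i, y_k^i, ⟦v_k^i⟧) ∩ S`, for the realization `ω`. -/
def update (ω : Ω) (k : ℕ) (i : V) (S : Set (EuclideanSpace ℝ (Fin n))) :
    Set (EuclideanSpace ℝ (Fin n)) :=
  compatibleStates (N.C i) (N.measurement i k ω) (range (N.v i k)) ∩ S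

/-- Fusion: intersection over the sensor itself and its in-neighbours. -/
def fuse (S : V → Set (EuclideanSpace ℝ (Fin n))) (i : V) : Set (EuclideanSpace ℝ (Fin n)) :=
  ⋂ j ∈ N.graph.closedInNeighbors i, S j

/-- The prior beliefs `𝓑_i⁻(x_k)` of the filter with initial prior beliefs `B₀`, for the
realization `ω` of the uncertain variables. -/
def priorBelief (B₀ : V → Set (EuclideanSpace ℝ (Fin n))) (ω : Ω) :
    ℕ → V → Set (EuclideanSpace ℝ (Fin n))
  | 0, i => B₀ i
  | k + 1, i => N.predict k (N.fuse (fun j => N.update ω k j (priorBelief B₀ ω k j)) i)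

/-- The local posterior beliefs `𝓑_i⁺(x_k)`. -/
def localBelief (B₀ : V → Set (EuclideanSpace ℝ (Fin n))) (ω : Ω) (k : ℕ) (i : V) :
    Set (EuclideanSpace ℝ (Fin n)) :=
  N.update ω k i (N.priorBelief B₀ ω k i)

/-- The beliefs `𝓑_i(x_k)`: the fused posteriors. -/
def belief (B₀ : V → Set (EuclideanSpace ℝ (Fin n))) (ω : Ω) (k : ℕ) (i : V) :
    Set (EuclideanSpace ℝ (Fin n)) :=
  N.fuse (N.localBelief B₀ ω k) i

theorem priorBelief_succ (B₀ : V → Set (EuclideanSpace ℝ (Fin n))) (ω : Ω) (k : ℕ) (i : V) :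
    N.priorBelief B₀ ω (k + 1) i = N.predict k (N.belief B₀ ω k i) := rfl

end SensorNetwork

/-! ### Observability decomposition and marginal stability -/

/-- Observability of the pair `(A, C)`: the matrix with the blocks `C, C A, …, C A^(n-1)` has
rank `n`. -/
def IsObservablePair {n : ℕ} {m : Type*} (A : Matrix (Fin n) (Fin n) ℝ)
    (C : Matrix m (Fin n) ℝ) : Prop :=
  (Matrix.of fun (r : Fin n × m) => (C * A ^ (r.1 : ℕ)) r.2).rank = n

/-- An observability decomposition of `(A, B, C)`: a nonsingular `P = col(P_o, P_ō)` such that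
`x̃ = P x` brings the system to block form with `(A_o, C_o)` observable. -/
structure ObservabilityDecomposition {n p : ℕ} {m : Type*} (A : Matrix (Fin n) (Fin n) ℝ)
    (B : Matrix (Fin n) (Fin p) ℝ) (C : Matrix m (Fin n) ℝ) where
  /-- dimension of the observable block -/
  no : ℕ
  /-- dimension of the unobservable block -/
  nu : ℕ
  /-- the coordinate change; its row blocks are `P_o` and `P_ō` -/
  P : Matrix (Fin no ⊕ Fin nu) (Fin n) ℝ
  /-- the inverse of `P` -/
  Pinv : Matrix (Fin n) (Fin no ⊕ Fin nu) ℝ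
  Ao : Matrix (Fin no) (Fin no) ℝ
  A21 : Matrix (Fin nu) (Fin no) ℝ
  /-- the unobservable block `Ã_ō` -/
  Au : Matrix (Fin nu) (Fin nu) ℝ
  Bo : Matrix (Fin no) (Fin p) ℝ
  /-- the block `B̃_ō` -/
  Bu : Matrix (Fin nu) (Fin p) ℝ
  Co : Matrix m (Fin no) ℝ
  mul_Pinv : P * Pinv = 1
  Pinv_mul : Pinv * P = 1
  A_eq : P * A * Pinv = Matrix.fromBlocks Ao 0 A21 Au
  B_eq : P * B = Matrix.fromRows Bo Bu
  C_eq : C * Pinv = Matrix.fromCols Co 0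
  observable : IsObservablePair Ao Co

/-- A real matrix regarded as a complex one. -/
abbrev Matrix.toComplex {m n : Type*} (M : Matrix m n ℝ) : Matrix m n ℂ :=
  M.map Complex.ofReal

/-- Marginal stability (discrete time): all complex eigenvalues have modulus at most one, and those
of modulus one are semisimple. -/
def IsMarginallyStable {n : ℕ} (M : Matrix (Fin n) (Fin n) ℝ) : Prop :=
  ∀ μ : ℂ, Module.End.HasEigenvalue (Matrix.toLin' M.toComplex) μ →
    ‖μ‖ ≤ 1 ∧ (‖μ‖ = 1 →
      Module.End.maxGenEigenspace (Matrix.toLin' M.toComplex) μ =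
        Module.End.eigenspace (Matrix.toLin' M.toComplex) μ)

/-- The rank condition: `rank [Ã_ō - μ I, B̃_ō, Ã₂₁] = rank (Ã_ō - μ I)` for every eigenvalue `μ`
of `Ã_ō` on the unit circle. -/
def ObservabilityDecomposition.RankCondition {n p : ℕ} {m : Type*}
    {A : Matrix (Fin n) (Fin n) ℝ} {B : Matrix (Fin n) (Fin p) ℝ} {C : Matrix m (Fin n) ℝ}
    (D : ObservabilityDecomposition A B C) : Prop :=
  ∀ μ : ℂ, Module.End.HasEigenvalue (Matrix.toLin' D.Au.toComplex) μ → ‖μ‖ = 1 →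
    (Matrix.fromCols (D.Au.toComplex - μ • 1)
      (Matrix.fromCols D.Bu.toComplex D.A21.toComplex)).rank
      = (D.Au.toComplex - μ • 1).rank

end

/-! ### Source components -/

/-! Take differences `e` of two points of one belief. A difference at sensor `i` arises from one at
any in-neighbour, or at `i` itself, by `e = A e' + B δ` with `δ` bounded, and `C_j e` is bounded at
sensor `j`, since both points explain the same measurement.

Some source component `S` has paths to `i`. Hence, for every large delay `d` and every `j ∈ S`, `e`
is within a bounded error of `A ^ d e'` with `e'` a difference at `j`; as `A` is invertible, `C_j
A⁻ᵈ e` is bounded (`Propagates.exists_norm_C_mulVec_le`). A window of consecutive delays, common to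
all `j ∈ S`, bounds enough outputs for observability to control the observable coordinates of `e`
(`exists_norm_obs_beliefDiff_le`).

The unobservable coordinates are followed along `i` alone. They obey a recursion with matrix `Au`
and bounded forcing, and the rank condition puts the forcing in the range of `Au - μ` whenever `|μ|
= 1`. The marginal modes are therefore not excited, and the others contract
(`exists_norm_le_of_marginallyStable`). -/

theorem Digraph.exists_isSourceComponent_hasPath {V : Type*} [Finite V] (G : Digraph V) (i : V) :
    ∃ S, G.IsSourceComponent S ∧ ∀ j ∈ S, G.HasPath j i := by
  let r : V → V → Prop := fun a b => G.HasPath a b ∧ ¬ G.HasPath b a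
  have : IsTrans V r := ⟨fun a b c hab hbc =>
    ⟨hab.1.trans hbc.1, fun h => hab.2 (hbc.1.trans h)⟩⟩
  have : Std.Irrefl r := ⟨fun a h => h.2 h.1⟩
  -- An ancestor of `i` that is minimal for strict reachability; its class admits no edge from
  -- outside.
  obtain ⟨m, hm, hmin⟩ := (Finite.wellFounded_of_trans_of_irrefl r).has_min
    {j | G.HasPath j i} ⟨i, Relation.ReflTransGen.refl⟩
  refine ⟨{j | G.HasPath m j ∧ G.HasPath j m}, ⟨⟨m, rfl⟩, ?_⟩, fun j hj => hj.2.trans hm⟩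
  intro a ha j hj haj
  have ham : G.HasPath a m := Relation.ReflTransGen.head haj hj.2
  have hma : G.HasPath m a := by
    by_contra h
    exact hmin a (ham.trans hm) ⟨ham, h⟩
  exact ha ⟨hma, ham⟩

/-! ### Linear maps between finite-dimensional spaces -/

theorem LinearMap.exists_norm_apply_le {𝕜 E F : Type*} [NontriviallyNormedField 𝕜]
    [CompleteSpace 𝕜] [NormedAddCommGroup E] [NormedSpace 𝕜 E] [FiniteDimensional 𝕜 E]
    [NormedAddCommGroup F] [NormedSpace 𝕜 F] (f : E →ₗ[𝕜] F) :
    ∃ c, 0 ≤ c ∧ ∀ x, ‖f x‖ ≤ c * ‖x‖ :=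
  ⟨‖LinearMap.toContinuousLinearMap f‖, norm_nonneg _,
    fun x => (LinearMap.toContinuousLinearMap f).le_opNorm x⟩

theorem Matrix.exists_norm_mulVec_le {m n : Type*} [Fintype m] [Fintype n] (M : Matrix m n ℝ) :
    ∃ c, 0 ≤ c ∧ ∀ x, ‖M *ᵥ x‖ ≤ c * ‖x‖ :=
  M.mulVecLin.exists_norm_apply_le

/-- A full column rank matrix is bounded below. -/
theorem Matrix.exists_norm_le_of_rank_eq {m : Type*} [Fintype m] {n : ℕ} (M : Matrix m (Fin n) ℝ)
    (h : M.rank = n) : ∃ c, 0 ≤ c ∧ ∀ x, ‖x‖ ≤ c * ‖M *ᵥ x‖ := by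
  have hker : LinearMap.ker M.mulVecLin = ⊥ := by
    have h1 := M.mulVecLin.finrank_range_add_finrank_ker
    have h2 : Module.finrank ℝ (LinearMap.range M.mulVecLin) = n := h
    rw [h2, Module.finrank_fin_fun] at h1
    exact Submodule.finrank_eq_zero.1 (by omega)
  obtain ⟨K, -, hK⟩ := M.mulVecLin.exists_antilipschitzWith hker
  refine ⟨K, K.2, fun x => ?_⟩
  simpa using hK.le_mul_dist x 0

/-! ### Marginally stable recursions -/

/-- `b / (1 - a)` is the fixed point of `t ↦ a * t + b`, so any larger bound is preserved by a step.
-/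
theorem exists_norm_le_of_contraction {E : Type*} (R : ℕ → Set E) (g : E → ℝ) {a b c₀ : ℝ}
    (ha : 0 ≤ a) (ha1 : a < 1) (h0 : ∀ u ∈ R 0, g u ≤ c₀)
    (hstep : ∀ l, ∀ u ∈ R (l + 1), ∃ u' ∈ R l, g u ≤ a * g u' + b) :
    ∃ c, ∀ l, ∀ u ∈ R l, g u ≤ c := by
  refine ⟨max c₀ (b / (1 - a)), fun l => ?_⟩
  induction l with
  | zero => exact fun u hu => (h0 u hu).trans (le_max_left _ _)
  | succ l ih =>
    intro u hu
    obtain ⟨u', hu', h⟩ := hstep l u hu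
    have h1 := mul_le_mul_of_nonneg_left (ih u' hu') ha
    have h2 : b ≤ max c₀ (b / (1 - a)) * (1 - a) :=
      (div_le_iff₀ (by linarith)).1 (le_max_right _ _)
    linarith

section MarginallyStable

variable {E : Type*} [NormedAddCommGroup E] [NormedSpace ℂ E] [FiniteDimensional ℂ E]

/-- Rank-nullity turns semisimplicity, a condition on kernels, into one on ranges, which is what
functionals can test. -/
theorem LinearMap.range_pow_eq_range_of_ker_pow_eq_ker {K M : Type*} [Field K] [AddCommGroup M]
    [Module K M] [FiniteDimensional K M] (f : Module.End K M) {m : ℕ} (hm : m ≠ 0)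
    (h : LinearMap.ker (f ^ m) = LinearMap.ker f) :
    LinearMap.range (f ^ m) = LinearMap.range f := by
  obtain ⟨m, rfl⟩ := Nat.exists_eq_succ_of_ne_zero hm
  apply Submodule.eq_of_le_of_finrank_eq
  · rintro _ ⟨x, rfl⟩
    exact ⟨(f ^ m) x, by rw [Nat.succ_eq_add_one, pow_succ']; rfl⟩
  · have h1 := (f ^ (m + 1)).finrank_range_add_finrank_ker
    have h2 := f.finrank_range_add_finrank_ker
    rw [Nat.succ_eq_add_one] at *
    rw [h] at h1
    omega

/-- The states that are reachable by `u' = T u + f` from a bounded set remain bounded when `T` is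
marginally stable and the bounded inputs `f` do not excite the modes on the unit circle. -/
theorem exists_norm_le_of_marginallyStable (T : Module.End ℂ E)
    (hT : ∀ μ, T.HasEigenvalue μ → ‖μ‖ ≤ 1 ∧
      (‖μ‖ = 1 → T.maxGenEigenspace μ = T.eigenspace μ))
    (R : ℕ → Set E) (F : Set E) {c₀ cF : ℝ} (h0 : ∀ u ∈ R 0, ‖u‖ ≤ c₀) (hF : ∀ f ∈ F, ‖f‖ ≤ cF)
    (hFr : ∀ μ, T.HasEigenvalue μ → ‖μ‖ = 1 →
      ∀ f ∈ F, f ∈ LinearMap.range (T - algebraMap ℂ (Module.End ℂ E) μ))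
    (hstep : ∀ l, ∀ u ∈ R (l + 1), ∃ u' ∈ R l, ∃ f ∈ F, u = T u' + f)
    (φ : Module.Dual ℂ E) : ∃ c, ∀ l, ∀ u ∈ R l, ‖φ u‖ ≤ c := by
  have hbd : ∀ (φ : Module.Dual ℂ E) (S : Set E) (c : ℝ), (∀ u ∈ S, ‖u‖ ≤ c) →
      ∃ c', ∀ u ∈ S, ‖φ u‖ ≤ c' := by
    intro φ S c hc
    obtain ⟨K, hK, h⟩ := φ.exists_norm_apply_le
    exact ⟨K * c, fun u hu => (h u).trans (mul_le_mul_of_nonneg_left (hc u hu) hK)⟩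
  -- Generalized left eigenvectors `φ` decouple the recursion into scalar ones.
  have hgen : ∀ (μ : ℂ) (m : ℕ) (φ : Module.Dual ℂ E),
      φ ∘ₗ ((T - algebraMap ℂ (Module.End ℂ E) μ) ^ m) = 0 →
      ∃ c, ∀ l, ∀ u ∈ R l, ‖φ u‖ ≤ c := by
    intro μ m
    by_cases hμ : T.HasEigenvalue μ
    swap
    · intro φ hφ
      have hker : LinearMap.ker (T - algebraMap ℂ (Module.End ℂ E) μ) = ⊥ := by
        by_contra h
        exact hμ (by rwa [Module.End.hasEigenvalue_iff, Module.End.eigenspace_def])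
      have hsurj : Function.Surjective ((T - algebraMap ℂ (Module.End ℂ E) μ) ^ m) := by
        rw [Module.End.coe_pow]
        exact (LinearMap.injective_iff_surjective.1 (LinearMap.ker_eq_bot.1 hker)).iterate m
      refine ⟨0, fun l u _ => ?_⟩
      obtain ⟨x, rfl⟩ := hsurj u
      have := LinearMap.congr_fun hφ x
      simp only [LinearMap.comp_apply, LinearMap.zero_apply] at this
      simp [this]
    rcases (hT μ hμ).1.lt_or_eq with hlt | heq
    -- Inside the disc, `φ ∘ (T - μ)` has a lower order, so it is already bounded and acts as extra
    -- forcing on a contraction of ratio `‖μ‖`.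
    · induction m with
      | zero =>
        intro φ hφ
        have : φ = 0 := by rwa [pow_zero, Module.End.one_eq_id, LinearMap.comp_id] at hφ
        exact ⟨0, by simp [this]⟩
      | succ m ih =>
        intro φ hφ
        obtain ⟨c₁, hc₁⟩ := ih (φ ∘ₗ (T - algebraMap ℂ (Module.End ℂ E) μ)) (by
          rw [pow_succ'] at hφ
          rw [LinearMap.comp_assoc]
          exact hφ)
        obtain ⟨c₂, hc₂⟩ := hbd φ F cF hF
        obtain ⟨c₃, hc₃⟩ := hbd φ (R 0) c₀ h0
        refine exists_norm_le_of_contraction R (fun u => ‖φ u‖) (norm_nonneg μ) hlt hc₃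
          (b := c₁ + c₂) fun l u hu => ?_
        obtain ⟨u', hu', f, hf, rfl⟩ := hstep l u hu
        refine ⟨u', hu', ?_⟩
        have e : φ (T u' + f) =
            μ * φ u' + ((φ ∘ₗ (T - algebraMap ℂ (Module.End ℂ E) μ)) u' + φ f) := by
          simp only [LinearMap.comp_apply, LinearMap.sub_apply, Module.algebraMap_end_apply,
            map_add, map_sub, map_smul, smul_eq_mul]
          ring
        rw [e, ← norm_mul]
        exact (norm_add_le _ _).trans (add_le_add le_rfl ((norm_add_le _ _).trans
          (add_le_add (hc₁ l u' hu') (hc₂ f hf))))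
    · intro φ hφ
      -- On the circle, semisimplicity makes `φ` a true left eigenvector. It kills the forcing, so
      -- `‖φ u‖` is conserved.
      have hφ1 : ∀ x ∈ LinearMap.range (T - algebraMap ℂ (Module.End ℂ E) μ), φ x = 0 := by
        intro x hx
        rcases eq_or_ne m 0 with rfl | hm
        · have : φ = 0 := by rwa [pow_zero, Module.End.one_eq_id, LinearMap.comp_id] at hφ
          simp [this]
        · rw [← LinearMap.range_pow_eq_range_of_ker_pow_eq_ker _ hm] at hx
          · obtain ⟨y, rfl⟩ := hx
            exact LinearMap.congr_fun hφ y
          · apply le_antisymm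
            · intro y hy
              have h2 : y ∈ T.maxGenEigenspace μ := (Module.End.mem_maxGenEigenspace _ _ _).2
                ⟨m, by rwa [← Algebra.algebraMap_eq_smul_one]⟩
              rwa [(hT μ hμ).2 heq, Module.End.eigenspace_def] at h2
            · intro y hy
              obtain ⟨m, rfl⟩ := Nat.exists_eq_succ_of_ne_zero hm
              rw [LinearMap.mem_ker] at hy ⊢
              rw [Nat.succ_eq_add_one, pow_succ, Module.End.mul_apply, hy, map_zero]
      obtain ⟨c₃, hc₃⟩ := hbd φ (R 0) c₀ h0
      refine ⟨c₃, fun l => ?_⟩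
      induction l with
      | zero => exact hc₃
      | succ l ih =>
        intro u hu
        obtain ⟨u', hu', f, hf, rfl⟩ := hstep l u hu
        have e1 : φ f = 0 := hφ1 f (hFr μ hμ heq f hf)
        have e2 : φ (T u') = μ * φ u' := by
          have := hφ1 _ ⟨u', rfl⟩
          simpa [Module.algebraMap_end_apply, sub_eq_zero] using this
        rw [map_add, e1, e2, add_zero, norm_mul, heq, one_mul]
        exact ih u' hu'
  let Q : Submodule ℂ (Module.Dual ℂ E) :=
    { carrier := {φ | ∃ c, ∀ l, ∀ u ∈ R l, ‖φ u‖ ≤ c}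
      zero_mem' := ⟨0, by simp⟩
      add_mem' := by
        rintro φ ψ ⟨a, ha⟩ ⟨b, hb⟩
        exact ⟨a + b, fun l u hu =>
          (norm_add_le _ _).trans (add_le_add (ha l u hu) (hb l u hu))⟩
      smul_mem' := by
        rintro z φ ⟨a, ha⟩
        refine ⟨‖z‖ * a, fun l u hu => ?_⟩
        rw [LinearMap.smul_apply, norm_smul]
        exact mul_le_mul_of_nonneg_left (ha l u hu) (norm_nonneg _) }
  -- Over `ℂ` the generalized eigenspaces of the dual map span the dual, and the bounded functionals
  -- form a subspace.
  have htop : (⊤ : Submodule ℂ (Module.Dual ℂ E)) ≤ Q := by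
    rw [← Module.End.iSup_maxGenEigenspace_eq_top (LinearMap.dualMap T : Module.End ℂ _)]
    refine iSup_le fun μ ψ hψ => ?_
    obtain ⟨m, hm⟩ := Module.End.mem_maxGenEigenspace _ _ _ |>.1 hψ
    refine hgen μ m ψ ?_
    rw [← hm]
    have e : (LinearMap.dualMap T - μ • 1 : Module.End ℂ (Module.Dual ℂ E)) =
        LinearMap.dualMap (T - algebraMap ℂ (Module.End ℂ E) μ) := by
      ext φ x
      simp [Module.algebraMap_end_apply]
    rw [e]
    clear e hm hψ
    induction m generalizing ψ with
    | zero => simp [Module.End.one_eq_id]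
    | succ m ih =>
      rw [pow_succ' (T - _), pow_succ, Module.End.mul_apply, ← ih]
      rfl
  exact htop (Submodule.mem_top (x := φ))

end MarginallyStable

/-! ### The blocks of an observability decomposition -/

/-- Appending columns without raising the rank leaves the column space unchanged. -/
theorem Matrix.mulVec_mem_range_of_rank_fromCols_eq {m n₁ n₂ : Type*} [Fintype m] [Fintype n₁]
    [Fintype n₂] (M : Matrix m n₁ ℂ) (N : Matrix m n₂ ℂ) (h : (Matrix.fromCols M N).rank = M.rank)
    (x : n₂ → ℂ) : N *ᵥ x ∈ LinearMap.range M.mulVecLin := by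
  have hle : LinearMap.range M.mulVecLin ≤ LinearMap.range (Matrix.fromCols M N).mulVecLin := by
    rintro _ ⟨y, rfl⟩
    exact ⟨Sum.elim y 0, by simp⟩
  rw [Submodule.eq_of_le_of_finrank_eq hle h.symm]
  exact ⟨Sum.elim 0 x, by simp⟩

theorem Matrix.toComplex_mulVec {m n : Type*} [Fintype n] (M : Matrix m n ℝ) (x : n → ℝ) :
    M.toComplex *ᵥ (fun i => (x i : ℂ)) = fun i => ((M *ᵥ x) i : ℂ) := by
  ext i
  simp [Matrix.mulVec, dotProduct]

namespace ObservabilityDecomposition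

variable {n p : ℕ} {m : Type*} {A : Matrix (Fin n) (Fin n) ℝ} {B : Matrix (Fin n) (Fin p) ℝ}
  {C : Matrix m (Fin n) ℝ} (D : ObservabilityDecomposition A B C)

/-- The observable coordinates of a vector. -/
def obs (e : Fin n → ℝ) : Fin D.no → ℝ := (D.P *ᵥ e) ∘ Sum.inl

/-- The unobservable coordinates of a vector. -/
def unobs (e : Fin n → ℝ) : Fin D.nu → ℝ := (D.P *ᵥ e) ∘ Sum.inr

theorem P_mulVec (e : Fin n → ℝ) : D.P *ᵥ e = Sum.elim (D.obs e) (D.unobs e) :=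
  (Sum.elim_comp_inl_inr _).symm

theorem Pinv_mulVec (e : Fin n → ℝ) : D.Pinv *ᵥ Sum.elim (D.obs e) (D.unobs e) = e := by
  rw [← D.P_mulVec, Matrix.mulVec_mulVec, D.Pinv_mul, Matrix.one_mulVec]

theorem P_mulVec_A (e : Fin n → ℝ) : D.P *ᵥ (A *ᵥ e) =
    Sum.elim (D.Ao *ᵥ D.obs e) (D.A21 *ᵥ D.obs e + D.Au *ᵥ D.unobs e) := by
  have h : D.P * A = Matrix.fromBlocks D.Ao 0 D.A21 D.Au * D.P := by
    rw [← D.A_eq, Matrix.mul_assoc, D.Pinv_mul, Matrix.mul_one]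
  rw [Matrix.mulVec_mulVec, h, ← Matrix.mulVec_mulVec, D.P_mulVec, Matrix.fromBlocks_mulVec]
  simp

theorem obs_A (e : Fin n → ℝ) : D.obs (A *ᵥ e) = D.Ao *ᵥ D.obs e := by
  rw [obs, D.P_mulVec_A, Sum.elim_comp_inl]

theorem obs_A_pow (k : ℕ) (e : Fin n → ℝ) : D.obs ((A ^ k) *ᵥ e) = (D.Ao ^ k) *ᵥ D.obs e := by
  induction k with
  | zero => simp
  | succ k ih => rw [pow_succ', pow_succ', ← Matrix.mulVec_mulVec, D.obs_A, ih,
      Matrix.mulVec_mulVec]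

theorem unobs_step (e : Fin n → ℝ) (δ : Fin p → ℝ) : D.unobs (A *ᵥ e + B *ᵥ δ) =
    D.Au *ᵥ D.unobs e + (D.A21 *ᵥ D.obs e + D.Bu *ᵥ δ) := by
  have h : D.P *ᵥ (B *ᵥ δ) = Sum.elim (D.Bo *ᵥ δ) (D.Bu *ᵥ δ) := by
    rw [Matrix.mulVec_mulVec, D.B_eq, Matrix.fromRows_mulVec]
  ext r
  simp only [unobs, Matrix.mulVec_add, D.P_mulVec_A, h, Function.comp_apply, Pi.add_apply,
    Sum.elim_inr]
  ring

theorem C_mulVec (e : Fin n → ℝ) : C *ᵥ e = D.Co *ᵥ D.obs e := by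
  have h : C = Matrix.fromCols D.Co (0 : Matrix m (Fin D.nu) ℝ) * D.P := by
    rw [← D.C_eq, Matrix.mul_assoc, D.Pinv_mul, Matrix.mul_one]
  conv_lhs => rw [h]
  rw [← Matrix.mulVec_mulVec, D.P_mulVec, Matrix.fromCols_mulVec_sumElim]
  simp

/-- The observable coordinates are controlled by the outputs over `n` steps. -/
theorem exists_norm_obs_le [Fintype m] : ∃ c, 0 ≤ c ∧ ∀ (e : Fin n → ℝ) (b : ℝ), 0 ≤ b →
    (∀ k < D.no, ∀ r, |(C *ᵥ ((A ^ k) *ᵥ e)) r| ≤ b) → ‖D.obs e‖ ≤ c * b := by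
  obtain ⟨c, hc, h⟩ := Matrix.exists_norm_le_of_rank_eq _ D.observable
  refine ⟨c, hc, fun e b hb hr => (h _).trans (mul_le_mul_of_nonneg_left ?_ hc)⟩
  rw [pi_norm_le_iff_of_nonneg hb]
  rintro ⟨k, r⟩
  have := hr k k.2 r
  rw [D.C_mulVec, D.obs_A_pow, Matrix.mulVec_mulVec] at this
  exact this

/-- Under marginal stability and the rank condition, states with bounded observable coordinates
that follow the system dynamics with bounded inputs are bounded. -/
theorem exists_norm_le (hst : IsMarginallyStable D.Au) (hrk : D.RankCondition)
    (R : ℕ → Set (Fin n → ℝ)) {c₀ co cδ : ℝ} (h0 : ∀ e ∈ R 0, ‖e‖ ≤ c₀)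
    (ho : ∀ l, ∀ e ∈ R l, ‖D.obs e‖ ≤ co)
    (hstep : ∀ l, ∀ e ∈ R (l + 1), ∃ e' ∈ R l, ∃ δ, ‖δ‖ ≤ cδ ∧ e = A *ᵥ e' + B *ᵥ δ) :
    ∃ c, ∀ l, ∀ e ∈ R l, ‖e‖ ≤ c := by
  let ι : (Fin D.nu → ℝ) → (Fin D.nu → ℂ) := fun u r => (u r : ℂ)
  have hι : ∀ u, ‖ι u‖ = ‖u‖ := fun u => by
    simp only [Pi.norm_def, ι]
    congr 2
    ext r
    simp
  let F : Set (Fin D.nu → ℂ) :=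
    {f | ∃ o δ, ‖o‖ ≤ co ∧ ‖δ‖ ≤ cδ ∧ f = ι (D.A21 *ᵥ o + D.Bu *ᵥ δ)}
  obtain ⟨cA, hcA, hA⟩ := D.A21.exists_norm_mulVec_le
  obtain ⟨cB, hcB, hB⟩ := D.Bu.exists_norm_mulVec_le
  obtain ⟨cP, hcP, hP⟩ := D.P.exists_norm_mulVec_le
  obtain ⟨cI, hcI, hI⟩ := D.Pinv.exists_norm_mulVec_le
  have hF : ∀ f ∈ F, ‖f‖ ≤ cA * co + cB * cδ := by
    rintro f ⟨o, δ, h1, h2, rfl⟩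
    rw [hι]
    refine (norm_add_le _ _).trans (add_le_add ((hA o).trans ?_) ((hB δ).trans ?_))
    · gcongr
    · gcongr
  have hU0 : ∀ u ∈ (fun e => ι (D.unobs e)) '' R 0, ‖u‖ ≤ cP * c₀ := by
    rintro _ ⟨e, he, rfl⟩
    dsimp only
    rw [hι]
    refine le_trans ?_ ((hP e).trans (mul_le_mul_of_nonneg_left (h0 e he) hcP))
    exact (pi_norm_le_iff_of_nonneg (norm_nonneg _)).2 fun r => norm_le_pi_norm (D.P *ᵥ e) _
  have hFr : ∀ μ, Module.End.HasEigenvalue (Matrix.toLin' D.Au.toComplex) μ → ‖μ‖ = 1 →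
      ∀ f ∈ F, f ∈ LinearMap.range
        (Matrix.toLin' D.Au.toComplex - algebraMap ℂ (Module.End ℂ (Fin D.nu → ℂ)) μ) := by
    rintro μ hμ h1 f ⟨o, δ, -, -, rfl⟩
    have h := Matrix.mulVec_mem_range_of_rank_fromCols_eq _ _ (hrk μ hμ h1)
      (Sum.elim (fun r => (δ r : ℂ)) (fun r => (o r : ℂ)))
    rw [Matrix.fromCols_mulVec_sumElim, Matrix.toComplex_mulVec, Matrix.toComplex_mulVec] at h
    obtain ⟨x, hx⟩ := h
    refine ⟨x, ?_⟩
    have e1 : (Matrix.toLin' D.Au.toComplex - algebraMap ℂ (Module.End ℂ (Fin D.nu → ℂ)) μ) x =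
        (D.Au.toComplex - μ • (1 : Matrix (Fin D.nu) (Fin D.nu) ℂ)).mulVecLin x := by
      simp [Module.algebraMap_end_apply]
    rw [e1, hx]
    ext r
    simp [ι, add_comm]
  have hUstep : ∀ l, ∀ u ∈ (fun e => ι (D.unobs e)) '' R (l + 1),
      ∃ u' ∈ (fun e => ι (D.unobs e)) '' R l, ∃ f ∈ F,
        u = Matrix.toLin' D.Au.toComplex u' + f := by
    rintro l _ ⟨e, he, rfl⟩
    obtain ⟨e', he', δ, hδ, rfl⟩ := hstep l e he
    refine ⟨_, ⟨e', he', rfl⟩, _, ⟨D.obs e', δ, ho l e' he', hδ, rfl⟩, ?_⟩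
    dsimp only
    rw [D.unobs_step, Matrix.toLin'_apply, Matrix.toComplex_mulVec]
    ext r
    simp [ι]
  have hU := fun r : Fin D.nu => exists_norm_le_of_marginallyStable
    (Matrix.toLin' D.Au.toComplex) hst (fun l => (fun e => ι (D.unobs e)) '' R l) F hU0 hF hFr
    hUstep (LinearMap.proj r)
  choose c hc using hU
  -- Absolute values, because the bounds may be negative when the sets are empty.
  refine ⟨cI * (|co| + ∑ r, |c r|), fun l e he => ?_⟩
  rw [← D.Pinv_mulVec e]
  refine (hI _).trans (mul_le_mul_of_nonneg_left ?_ hcI)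
  have hs : 0 ≤ ∑ r, |c r| := Finset.sum_nonneg fun r _ => abs_nonneg _
  refine (pi_norm_le_iff_of_nonneg (by positivity)).2 ?_
  rintro (r | r)
  · have h1 := norm_le_pi_norm (D.obs e) r
    have h2 := ho l e he
    have h3 := le_abs_self co
    simp only [Sum.elim_inl]
    linarith
  · have h1 := hc r l _ ⟨e, he, rfl⟩
    have h2 := Finset.single_le_sum (f := fun r => |c r|) (fun r _ => abs_nonneg _)
      (Finset.mem_univ r)
    have h3 := le_abs_self (c r)
    have h4 := abs_nonneg co
    simp only [LinearMap.proj_apply, ι, Complex.norm_real] at h1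
    simp only [Sum.elim_inr]
    linarith

end ObservabilityDecomposition

/-! ### Belief differences and their propagation through the network -/

theorem EuclideanSpace.norm_ofLp_le {m : ℕ} (x : EuclideanSpace ℝ (Fin m)) :
    ‖WithLp.ofLp x‖ ≤ ‖x‖ :=
  (pi_norm_le_iff_of_nonneg (norm_nonneg _)).2 fun r => PiLp.norm_apply_le x r

theorem Metric.exists_dist_le_of_iSup_ediam_lt_top {ι X : Type*} [PseudoMetricSpace X]
    (S : ι → Set X) (h : ⨆ k, Metric.ediam (S k) < ⊤) :
    ∃ c, 0 ≤ c ∧ ∀ k, ∀ x ∈ S k, ∀ y ∈ S k, dist x y ≤ c := by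
  refine ⟨(⨆ k, Metric.ediam (S k)).toReal, ENNReal.toReal_nonneg, fun k x hx y hy => ?_⟩
  rw [dist_edist]
  exact ENNReal.toReal_mono h.ne ((Metric.edist_le_ediam_of_mem hx hy).trans
    (le_iSup (fun k => Metric.ediam (S k)) k))

namespace SensorNetwork

variable {V Ω : Type*} {n p : ℕ} (N : SensorNetwork V Ω n p)
  (B₀ : V → Set (EuclideanSpace ℝ (Fin n))) (ω : Ω)

/-- The differences of two elements of the belief `𝓑_i(x_k)`. -/
def beliefDiff (i : V) (k : ℕ) : Set (Fin n → ℝ) :=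
  {e | ∃ x ∈ N.belief B₀ ω k i, ∃ z ∈ N.belief B₀ ω k i, e = WithLp.ofLp x - WithLp.ofLp z}

variable {B₀ ω}

theorem mem_localBelief {i j : V} (hj : j ∈ N.graph.closedInNeighbors i) {k : ℕ}
    {x : EuclideanSpace ℝ (Fin n)} (hx : x ∈ N.belief B₀ ω k i) : x ∈ N.localBelief B₀ ω k j :=
  mem_iInter₂.1 hx j hj

theorem _root_.Digraph.self_mem_closedInNeighbors {V : Type*} (G : Digraph V) (i : V) :
    i ∈ G.closedInNeighbors i := Or.inl rfl

/-- A belief difference evolves from one of any in-neighbour by the system dynamics. -/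
theorem exists_beliefDiff_pred {W : ℝ}
    (hW : ∀ k, ∀ x ∈ range (N.w k), ∀ y ∈ range (N.w k), dist x y ≤ W)
    {i j : V} (hj : j ∈ N.graph.closedInNeighbors i) {k : ℕ} {e : Fin n → ℝ}
    (he : e ∈ N.beliefDiff B₀ ω i (k + 1)) :
    ∃ e' ∈ N.beliefDiff B₀ ω j k, ∃ δ, ‖δ‖ ≤ W ∧ e = N.A *ᵥ e' + N.B *ᵥ δ := by
  obtain ⟨x, hx, z, hz, rfl⟩ := he
  obtain ⟨_, ⟨x', hx', rfl⟩, _, ⟨a, ha, rfl⟩, rfl⟩ := (N.mem_localBelief hj hx).2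
  obtain ⟨_, ⟨z', hz', rfl⟩, _, ⟨b, hb, rfl⟩, rfl⟩ := (N.mem_localBelief hj hz).2
  refine ⟨_, ⟨x', hx', z', hz', rfl⟩, WithLp.ofLp (a - b), ?_, ?_⟩
  · exact (EuclideanSpace.norm_ofLp_le _).trans (by rw [← dist_eq_norm]; exact hW k a ha b hb)
  · simp only [WithLp.ofLp_add, WithLp.ofLp_sub, Matrix.ofLp_toLpLin, Matrix.toLin'_apply,
      Matrix.mulVec_sub]
    abel

/-- Both points explain the same measurement, so their outputs differ by a difference of two noise
values. -/
theorem norm_C_mulVec_beliefDiff_le {j : V} {c : ℝ}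
    (hv : ∀ k, ∀ x ∈ range (N.v j k), ∀ y ∈ range (N.v j k), dist x y ≤ c)
    {k : ℕ} {e : Fin n → ℝ} (he : e ∈ N.beliefDiff B₀ ω j k) : ‖N.C j *ᵥ e‖ ≤ c := by
  obtain ⟨x, hx, z, hz, rfl⟩ := he
  obtain ⟨a, ha, hxa⟩ := (N.mem_localBelief (N.graph.self_mem_closedInNeighbors j) hx).1
  obtain ⟨b, hb, hzb⟩ := (N.mem_localBelief (N.graph.self_mem_closedInNeighbors j) hz).1
  have h : N.C j *ᵥ (WithLp.ofLp x - WithLp.ofLp z) = WithLp.ofLp (b - a) := by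
    have h := congrArg WithLp.ofLp (hxa.symm.trans hzb)
    simp only [WithLp.ofLp_add, Matrix.ofLp_toLpLin, Matrix.toLin'_apply] at h
    rw [Matrix.mulVec_sub, WithLp.ofLp_sub, sub_eq_sub_iff_add_eq_add, h, add_comm]
  rw [h]
  exact (EuclideanSpace.norm_ofLp_le _).trans
    (by rw [← dist_eq_norm]; exact hv k b hb a ha)

theorem exists_norm_beliefDiff_zero_le {i : V} (hi : Metric.ediam (B₀ i) < ⊤) :
    ∃ c, ∀ e ∈ N.beliefDiff B₀ ω i 0, ‖e‖ ≤ c := by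
  obtain ⟨c, -, hc⟩ := Metric.exists_dist_le_of_iSup_ediam_lt_top (fun _ : Unit => B₀ i)
    (by simpa using hi)
  refine ⟨c, ?_⟩
  rintro _ ⟨x, hx, z, hz, rfl⟩
  have h := hc () x (N.mem_localBelief (N.graph.self_mem_closedInNeighbors i) hx).2
    z (N.mem_localBelief (N.graph.self_mem_closedInNeighbors i) hz).2
  rw [dist_eq_norm] at h
  exact (EuclideanSpace.norm_ofLp_le _).trans h

/-- At each time, the differences of a belief with a bounded initial prior are bounded. -/
theorem exists_norm_beliefDiff_le {W : ℝ}
    (hW : ∀ k, ∀ x ∈ range (N.w k), ∀ y ∈ range (N.w k), dist x y ≤ W)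
    {i : V} (hi : Metric.ediam (B₀ i) < ⊤) (k : ℕ) :
    ∃ c, ∀ e ∈ N.beliefDiff B₀ ω i k, ‖e‖ ≤ c := by
  induction k with
  | zero => exact N.exists_norm_beliefDiff_zero_le hi
  | succ k ih =>
    obtain ⟨c, hc⟩ := ih
    obtain ⟨cA, hcA, hA⟩ := N.A.exists_norm_mulVec_le
    obtain ⟨cB, hcB, hB⟩ := N.B.exists_norm_mulVec_le
    refine ⟨cA * c + cB * W, fun e he => ?_⟩
    obtain ⟨e', he', δ, hδ, rfl⟩ :=
      N.exists_beliefDiff_pred hW (N.graph.self_mem_closedInNeighbors i) he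
    refine (norm_add_le _ _).trans (add_le_add ((hA _).trans ?_) ((hB _).trans ?_))
    · exact mul_le_mul_of_nonneg_left (hc e' he') hcA
    · exact mul_le_mul_of_nonneg_left hδ hcB

variable (B₀ ω) in
/-- Up to a bounded error, every belief difference of `i` is propagated from one of `j` that is
`d` time steps older. -/
def Propagates (j i : V) (d : ℕ) : Prop :=
  ∃ c, ∀ k, ∀ e ∈ N.beliefDiff B₀ ω i (k + d), ∃ e' ∈ N.beliefDiff B₀ ω j k,
    ‖e - (N.A ^ d) *ᵥ e'‖ ≤ c

variable {N}

theorem Propagates.of_mem_closedInNeighbors {W : ℝ}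
    (hW : ∀ k, ∀ x ∈ range (N.w k), ∀ y ∈ range (N.w k), dist x y ≤ W)
    {h j i : V} {d : ℕ} (hp : N.Propagates B₀ ω j i d) (hh : h ∈ N.graph.closedInNeighbors j) :
    N.Propagates B₀ ω h i (d + 1) := by
  obtain ⟨c, hc⟩ := hp
  obtain ⟨K, hK, hM⟩ := (N.A ^ d * N.B).exists_norm_mulVec_le
  refine ⟨c + K * W, fun k e he => ?_⟩
  obtain ⟨e', he', h1⟩ := hc (k + 1) e (by rwa [add_right_comm, add_assoc])
  obtain ⟨e'', he'', δ, hδ, rfl⟩ := N.exists_beliefDiff_pred hW hh he'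
  refine ⟨e'', he'', ?_⟩
  have e1 : e - (N.A ^ (d + 1)) *ᵥ e'' =
      (e - (N.A ^ d) *ᵥ (N.A *ᵥ e'' + N.B *ᵥ δ)) + (N.A ^ d * N.B) *ᵥ δ := by
    rw [Matrix.mulVec_add, Matrix.mulVec_mulVec, Matrix.mulVec_mulVec, pow_succ]
    abel
  rw [e1]
  exact (norm_add_le _ _).trans (add_le_add h1 ((hM δ).trans
    (mul_le_mul_of_nonneg_left hδ hK)))

/-- A path yields one delay; waiting at `j`, which belongs to its own closed in-neighbourhood,
yields every larger one. This allows one delay to serve many sensors. -/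
theorem eventually_propagates {W : ℝ}
    (hW : ∀ k, ∀ x ∈ range (N.w k), ∀ y ∈ range (N.w k), dist x y ≤ W)
    {j i : V} (hji : N.graph.HasPath j i) : ∀ᶠ d in atTop, N.Propagates B₀ ω j i d := by
  have h : ∃ d, N.Propagates B₀ ω j i d := by
    induction hji using Relation.ReflTransGen.head_induction_on with
    | refl => exact ⟨0, 0, fun k e he => ⟨e, he, by simp⟩⟩
    | head hab _ ih =>
      obtain ⟨d, hd⟩ := ih
      exact ⟨d + 1, hd.of_mem_closedInNeighbors hW (Or.inr hab)⟩
  obtain ⟨d₀, h₀⟩ := h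
  refine eventually_atTop.2 ⟨d₀, fun d hd => ?_⟩
  induction d, hd using Nat.le_induction with
  | base => exact h₀
  | succ d _ ih =>
    exact ih.of_mem_closedInNeighbors hW (N.graph.self_mem_closedInNeighbors j)

theorem Propagates.exists_norm_C_mulVec_le (hA : IsUnit N.A) {c : ℝ} {j i : V} {d : ℕ}
    (hv : ∀ k, ∀ x ∈ range (N.v j k), ∀ y ∈ range (N.v j k), dist x y ≤ c)
    (hp : N.Propagates B₀ ω j i d) :
    ∃ b, ∀ k, ∀ e ∈ N.beliefDiff B₀ ω i (k + d), ‖N.C j *ᵥ ((N.A⁻¹ ^ d) *ᵥ e)‖ ≤ b := by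
  obtain ⟨a, ha⟩ := hp
  obtain ⟨K, hK, hM⟩ := (N.C j * N.A⁻¹ ^ d).exists_norm_mulVec_le
  refine ⟨c + K * a, fun k e he => ?_⟩
  obtain ⟨e', he', h1⟩ := ha k e he
  have hdet := (Matrix.isUnit_iff_isUnit_det _).1 hA
  have e1 : N.C j *ᵥ ((N.A⁻¹ ^ d) *ᵥ e) =
      N.C j *ᵥ e' + (N.C j * N.A⁻¹ ^ d) *ᵥ (e - (N.A ^ d) *ᵥ e') := by
    have h2 : (N.A⁻¹ ^ d) *ᵥ ((N.A ^ d) *ᵥ e') = e' := by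
      rw [Matrix.mulVec_mulVec, Matrix.inv_pow', Matrix.nonsing_inv_mul _
        (by rw [Matrix.det_pow]; exact hdet.pow d), Matrix.one_mulVec]
    rw [Matrix.mulVec_sub, ← Matrix.mulVec_mulVec, ← Matrix.mulVec_mulVec, h2]
    abel
  rw [e1]
  exact (norm_add_le _ _).trans (add_le_add (N.norm_C_mulVec_beliefDiff_le hv he')
    ((hM _).trans (mul_le_mul_of_nonneg_left h1 hK)))

/-- The observable coordinates of the belief differences are eventually bounded at every sensor
that all sensors of `S` have a path to. -/
theorem exists_norm_obs_beliefDiff_le [Finite V] (hA : IsUnit N.A)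
    (hw : ⨆ k, Metric.ediam (range (N.w k)) < ⊤)
    (hv : ∀ i, ⨆ k, Metric.ediam (range (N.v i k)) < ⊤) {S : Set V} {i : V}
    (hS : ∀ j ∈ S, N.graph.HasPath j i) (D : ObservabilityDecomposition N.A N.B (N.jointC S)) :
    ∃ L c, ∀ k, ∀ e ∈ N.beliefDiff B₀ ω i (L + k), ‖D.obs e‖ ≤ c := by
  obtain ⟨W, -, hW⟩ := Metric.exists_dist_le_of_iSup_ediam_lt_top _ hw
  choose cv _ hcv using fun j => Metric.exists_dist_le_of_iSup_ediam_lt_top _ (hv j)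
  have h1 : ∀ᶠ d in atTop, ∀ j : S, N.Propagates B₀ ω j i d :=
    eventually_all.2 fun j => eventually_propagates hW (hS j j.2)
  obtain ⟨d₀, hd₀⟩ := eventually_atTop.1 h1
  -- The delays `d₀ + 1, …, d₀ + no` correspond to the outputs `C A ^ m`, `m < no`, of the vector
  -- `A⁻¹ ^ (d₀ + no) e`.
  choose b hb using fun (j : S) (m : Fin D.no) =>
    (hd₀ (d₀ + (D.no - m)) (by omega) j).exists_norm_C_mulVec_le hA (hcv j)
  have := Fintype.ofFinite S
  have := Fintype.ofFinite (Σ j : S, Fin (N.q j))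
  obtain ⟨cO, hcO, hO⟩ := D.exists_norm_obs_le
  obtain ⟨K, hK, hM⟩ := (D.Ao ^ (d₀ + D.no)).exists_norm_mulVec_le
  refine ⟨d₀ + D.no, K * (cO * ∑ j, ∑ m, |b j m|), fun k e he => ?_⟩
  have hdet := (Matrix.isUnit_iff_isUnit_det _).1 hA
  have hinv : ∀ l, N.A ^ l * N.A⁻¹ ^ l = 1 := fun l => by
    rw [Matrix.inv_pow', Matrix.mul_nonsing_inv _ (by rw [Matrix.det_pow]; exact hdet.pow l)]
  have he1 : e = (N.A ^ (d₀ + D.no)) *ᵥ ((N.A⁻¹ ^ (d₀ + D.no)) *ᵥ e) := by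
    rw [Matrix.mulVec_mulVec, hinv, Matrix.one_mulVec]
  rw [he1, D.obs_A_pow]
  refine (hM _).trans (mul_le_mul_of_nonneg_left (hO _ _ (by positivity) ?_) hK)
  rintro m hm ⟨j, r⟩
  have e2 : N.A ^ m * N.A⁻¹ ^ (d₀ + D.no) = N.A⁻¹ ^ (d₀ + (D.no - m)) := by
    rw [show d₀ + D.no = m + (d₀ + (D.no - m)) by omega, pow_add, ← Matrix.mul_assoc, hinv,
      Matrix.one_mul]
  have e3 : d₀ + D.no + k = k + m + (d₀ + (D.no - m)) := by omega
  have h3 := hb j ⟨m, hm⟩ (k + m) e (by rwa [e3] at he)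
  have h4 := norm_le_pi_norm (N.C j *ᵥ ((N.A⁻¹ ^ (d₀ + (D.no - m))) *ᵥ e)) r
  rw [Matrix.mulVec_mulVec _ (N.A ^ m), e2]
  calc |(N.jointC S *ᵥ ((N.A⁻¹ ^ (d₀ + (D.no - m))) *ᵥ e)) ⟨j, r⟩|
      ≤ b j ⟨m, hm⟩ := h4.trans h3
    _ ≤ |b j ⟨m, hm⟩| := le_abs_self _
    _ ≤ ∑ m, |b j m| := Finset.single_le_sum (f := fun m => |b j m|)
        (fun _ _ => abs_nonneg _) (Finset.mem_univ _)
    _ ≤ ∑ j, ∑ m, |b j m| := Finset.single_le_sum (f := fun j => ∑ m, |b j m|)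
        (fun _ _ => Finset.sum_nonneg fun _ _ => abs_nonneg _) (Finset.mem_univ _)

theorem exists_ediam_belief_le {i : V} {L : ℕ} {c : ℝ}
    (hc : ∀ k, ∀ e ∈ N.beliefDiff B₀ ω i (L + k), ‖e‖ ≤ c) :
    ∃ M : NNReal, ∀ k, Metric.ediam (N.belief B₀ ω (L + k) i) ≤ M := by
  obtain ⟨K, hK, h⟩ :=
    (WithLp.linearEquiv 2 ℝ (Fin n → ℝ)).symm.toLinearMap.exists_norm_apply_le
  refine ⟨(K * c).toNNReal, fun k => Metric.ediam_le fun x hx z hz => ?_⟩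
  rw [edist_dist]
  refine ENNReal.ofReal_le_ofReal ?_
  rw [dist_eq_norm]
  exact (h (WithLp.ofLp x - WithLp.ofLp z)).trans
    (mul_le_mul_of_nonneg_left (hc k _ ⟨x, hx, z, hz, rfl⟩) hK)

end SensorNetwork

theorem theorem1 {V Ω : Type*} [Finite V] {n p : ℕ} (N : SensorNetwork V Ω n p)
    (hA : IsUnit N.A)
    (hw : ⨆ k, Metric.ediam (range (N.w k)) < ⊤)
    (hv : ∀ i, ⨆ k, Metric.ediam (range (N.v i k)) < ⊤)
    (B₀ : V → Set (EuclideanSpace ℝ (Fin n)))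
    (hsource : ∀ S : Set V, N.graph.IsSourceComponent S →
      ∃ D : ObservabilityDecomposition N.A N.B (N.jointC S),
        IsMarginallyStable D.Au ∧ D.RankCondition)
    (ω : Ω) (i : V) (hi : Metric.ediam (B₀ i) < ⊤) :
    limsup (fun k => Metric.ediam (N.belief B₀ ω k i)) atTop < ⊤ := by
  obtain ⟨S, hS, hSi⟩ := N.graph.exists_isSourceComponent_hasPath i
  obtain ⟨D, hst, hrk⟩ := hsource S hS
  obtain ⟨L, co, ho⟩ := SensorNetwork.exists_norm_obs_beliefDiff_le (B₀ := B₀) (ω := ω)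
    hA hw hv hSi D
  obtain ⟨W, -, hW⟩ := Metric.exists_dist_le_of_iSup_ediam_lt_top _ hw
  -- The recursion for the unobservable part starts at time `L`; the bounded initial prior of `i`
  -- serves only to bound the differences there.
  obtain ⟨c₀, h₀⟩ := N.exists_norm_beliefDiff_le (ω := ω) hW hi L
  obtain ⟨c, hc⟩ := D.exists_norm_le hst hrk (fun k => N.beliefDiff B₀ ω i (L + k)) h₀ ho
    fun k e he => N.exists_beliefDiff_pred hW (N.graph.self_mem_closedInNeighbors i) he
  obtain ⟨M, hM⟩ := SensorNetwork.exists_ediam_belief_le hc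
  refine (limsup_le_of_le (a := (M : ENNReal)) (by isBoundedDefault) ?_).trans_lt
    ENNReal.coe_lt_top
  refine eventually_atTop.2 ⟨L, fun k hk => ?_⟩
  obtain ⟨l, rfl⟩ := Nat.exists_eq_add_of_le hk
  exact hM l
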